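/- Conventions. Let $\mathrm{Cat}$ be the category of small categories and $e$ the point category. For a functor $u:A\to B$ and an object $b$ of $B$, let $A/b$ (resp. $b\backslash A$) be the category of pairs $(a,\,u(a)\to b)$ (resp. $(a,\,b\to u(a))$). A class $W$ of arrows of $\mathrm{Cat}$ is a \emph{weak fundamental localizer} if: (i) $W$ contains the identities, satisfies the two-out-of-three property, and $r\in W$ whenever $i:A'\to A$ and $r:A\to A'$ satisfy $ri=\mathrm{id}_{A'}$ and $ir\in W$; (ii) $(A\to e)\in W$ for every small category $A$ having a terminal object; (iii) $u:A\to B$ belongs to $W$ whenever the functor $A/b\to B/b$ induced by $u$ belongs to $W$ for every object $b$ of $B$. A small category $A$ is \emph{$W$-aspherical} if $(A\to e)\in W$; a functor $u:A\to B$ is \emph{$W$-coaspherical} if the induced functor $b\backslash A\to b\backslash B$ is in $W$ for every object $b$ of $B$. A \emph{square} $\mathcal D$ consists of small categories $A',A,B',B$, functors $v:A'\to A$ (top), $u':A'\to B'$ (left), $u:A\to B$ (right), $w:B'\to B$ (bottom), and a natural transformation $\alpha:uv\to wu'$. It is a \emph{comma square} if the canonical functor from $A'$ to the comma category of triples $(a,b',g:u(a)\to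 w(b'))$ is an isomorphism of categories. Its \emph{opposite} is the square with natural transformation $\alpha^{op}$, top functor $u'^{op}$, left functor $v^{op}$, right functor $w^{op}$ and bottom functor $u^{op}$. If $\mathcal D'$ is a square $(v',u'',u',w',\alpha')$ whose right functor is the left functor $u'$ of $\mathcal D$, the \emph{horizontal composite} $\mathcal D\circ\mathcal D'$ is $(vv',u'',u,ww',(w\star\alpha')(\alpha\star v'))$. The square $\mathcal D$ is \emph{$W$-exact} if for every object $b'$ of $B'$ the functor $A'/b'\to A/w(b')$, $(a',g')\mapsto(v(a'),\,w(g')\alpha_{a'})$, is $W$-coaspherical. It is \emph{exact in the sense of Guitart} if the base change morphism $v_!\,u'^*\to u^*\,w_!$ between functors on presheaves of sets is an isomorphism, where $f^*$ denotes precomposition with $f^{op}$ and $f_!$ its left adjoint. All classes of squares are understood to be stable under isomorphism of squares. A class $Q$ of squares satisfies \emph{local descent} if a square $\mathcal D$ as above belongs to $Q$ as soon as, for every object $b'$ of $B'$, the horizontal composite of $\mathcal D$ with the comma square with upper left corner $A'/b'$, upper right corner $A'$, lower left corner $e$ and lower right corner $B'$, on the functors $u':A'\to B'$ and $b':e\to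 B'$, belongs to $Q$. \textbf{Theorem.} Let $W$ be a weak fundamental localizer. The class of $W$-exact squares is the smallest class of squares that is stable under passage to opposite categories, is stable under horizontal composition, satisfies local descent, contains the comma squares, and contains, for every $W$-aspherical small category $A$, the square with upper left corner $A$ and the three other corners equal to $e$ (with its only possible functors and natural transformation). \textbf{Corollary.} The class $W_0$ of functors inducing a bijection on the sets of connected components is a weak fundamental localizer, and a square is exact in the sense of Guitart if and only if it is $W_0$-exact. The class of Guitart's exact squares is the smallest class of squares that is stable under passage to opposite categories, is stable under horizontal composition, satisfies local descent, contains the comma squares, and contains, for every $0$-connected (that is, non-empty and connected) small category $A$, the square with upper left corner $A$ and the three other corners equal to $e$. -/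

import Mathlib

open CategoryTheory CategoryTheory.Limits

universe u

namespace ExactSquares

/-! ### Weak fundamental localizers -/

/-- The point category `e`. -/
abbrev Pt : Type u := Discrete PUnit.{u + 1}

/-- For a class `W` of arrows of the category of small categories, a small category `A` is
`W`-aspherical if the functor from `A` to the point category belongs to `W`. -/
def IsAspherical (W : MorphismProperty Cat.{u, u}) (A : Type u) [SmallCategory A] : Prop :=
  W (Functor.star.{u} A).toCatHom

/-- Weak fundamental localizers: weakly saturated classes of arrows of the category of small
categories (the first three fields) for which categories with a terminal object are aspherical,
and which contain every functor `F : A ⥤ B` such that all functors `A/b ⥤ B/b` induced by `F`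
belong to the class. -/
structure IsWeakFundamentalLocalizer (W : MorphismProperty Cat.{u, u}) : Prop where
  containsIdentities : W.ContainsIdentities
  twoOutOfThree : W.HasTwoOutOfThreeProperty
  of_retraction : ∀ {A₁ A : Cat.{u, u}} (i : A₁ ⟶ A) (r : A ⟶ A₁),
    i ≫ r = 𝟙 A₁ → W (r ≫ i) → W r
  aspherical_of_hasTerminal : ∀ (A : Type u) [SmallCategory A] [HasTerminal A],
    IsAspherical W A
  of_over : ∀ {A B : Type u} [SmallCategory A] [SmallCategory B] (F : A ⥤ B),
    (∀ b : B, W (CostructuredArrow.toOver F b).toCatHom) → W F.toCatHom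

/-- `F : A ⥤ B` is `W`-coaspherical if all functors `b\A ⥤ b\B` induced by `F` belong to `W`. -/
def IsCoaspherical (W : MorphismProperty Cat.{u, u}) {A B : Type u} [SmallCategory A]
    [SmallCategory B] (F : A ⥤ B) : Prop :=
  ∀ b : B, W (StructuredArrow.toUnder b F).toCatHom

/-- The class `W₀` of functors inducing a bijection between sets of connected components. -/
def wZero : MorphismProperty Cat.{u, u} :=
  fun _ _ F => Function.Bijective F.toFunctor.mapConnectedComponents

/-! ### Squares -/

/-- A square of small categories: four small categories, four functors
```
       top
   tl ----> tr
   |         |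
left|         | right
   v         v
   bl ----> br
      bottom
```
and a natural transformation `top ⋙ right ⟶ left ⋙ bottom`. -/
structure Square where
  tl : Cat.{u, u}
  tr : Cat.{u, u}
  bl : Cat.{u, u}
  br : Cat.{u, u}
  top : tl ⥤ tr
  left : tl ⥤ bl
  right : tr ⥤ br
  bottom : bl ⥤ br
  cell : TwoSquare top left right bottom

namespace Square

/-- The square given by a natural transformation `T ⋙ R ⟶ L ⋙ B`. -/
abbrev of {C₁ C₂ C₃ C₄ : Type u} [SmallCategory C₁] [SmallCategory C₂] [SmallCategory C₃]
    [SmallCategory C₄] {T : C₁ ⥤ C₂} {L : C₁ ⥤ C₃} {R : C₂ ⥤ C₄} {B : C₃ ⥤ C₄}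
    (σ : TwoSquare T L R B) : Square.{u} where
  tl := Cat.of C₁
  tr := Cat.of C₂
  bl := Cat.of C₃
  br := Cat.of C₄
  top := T
  left := L
  right := R
  bottom := B
  cell := σ

/-- The square of opposite categories; its upper right corner is the opposite of the lower left
corner of the original one. -/
def op (D : Square.{u}) : Square.{u} := of (TwoSquare.op D.cell)

/-- Two squares are isomorphic if there are isomorphisms of categories between their corners,
strictly compatible with the functors and with the natural transformations. -/
def IsIsomorphic (D E : Square.{u}) : Prop :=
  ∃ (i₁ : D.tl ≅ E.tl) (i₂ : D.tr ≅ E.tr) (i₃ : D.bl ≅ E.bl) (i₄ : D.br ≅ E.br),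
    D.top ⋙ i₂.hom.toFunctor = i₁.hom.toFunctor ⋙ E.top ∧
    D.left ⋙ i₃.hom.toFunctor = i₁.hom.toFunctor ⋙ E.left ∧
    D.right ⋙ i₄.hom.toFunctor = i₂.hom.toFunctor ⋙ E.right ∧
    D.bottom ⋙ i₄.hom.toFunctor = i₃.hom.toFunctor ⋙ E.bottom ∧
    ∀ x : D.tl, HEq (i₄.hom.toFunctor.map (D.cell.natTrans.app x))
      (E.cell.natTrans.app (i₁.hom.toFunctor.obj x))

/-- The 2-cell of the standard comma square on `R` and `B`, with upper left corner the comma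
category whose objects are triples `(x, y, g : R x ⟶ B y)`. -/
def commaCell {C₂ C₃ C₄ : Type u} [SmallCategory C₂] [SmallCategory C₃] [SmallCategory C₄]
    (R : C₂ ⥤ C₄) (B : C₃ ⥤ C₄) : TwoSquare (Comma.fst R B) (Comma.snd R B) R B :=
  Comma.natTrans R B

/-- The canonical functor from the upper left corner of a square to the comma category of
its right and bottom functors. -/
def toComma (D : Square.{u}) : D.tl ⥤ Comma D.right D.bottom where
  obj x :=
    { left := D.top.obj x
      right := D.left.obj x
      hom := D.cell.natTrans.app x }
  map f :=
    { left := D.top.map f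
      right := D.left.map f
      w := D.cell.natTrans.naturality f }

/-- A comma square: the canonical functor to the comma category is an isomorphism of
categories. -/
def IsComma (D : Square.{u}) : Prop := IsIso D.toComma.toCatHom

/-- The square with upper left corner `A` and all other corners the point category. -/
def point (A : Type u) [SmallCategory A] : Square.{u} :=
  of (TwoSquare.mk (Functor.star.{u} A) (Functor.star.{u} A) (𝟭 Pt.{u}) (𝟭 Pt.{u}) (𝟙 _))

/-- `W`-exact squares: for every object `y` of the lower left corner, the functor
`tl/y ⥤ tr/(bottom y)` induced by the top functor and the natural transformation is
`W`-coaspherical. -/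
def IsExact (W : MorphismProperty Cat.{u, u}) (D : Square.{u}) : Prop :=
  ∀ y : D.bl, IsCoaspherical W (D.cell.costructuredArrowRightwards y)

/-- Guitart exact squares: the base change morphism `top_! ∘ left^* ⟶ right^* ∘ bottom_!` between
functors on presheaves of sets is an isomorphism, where `F^*` is precomposition with the opposite
of `F` and `F_!` is its left adjoint. -/
def IsGuitartExact (D : Square.{u}) : Prop :=
  IsIso ((TwoSquare.op D.cell).lanBaseChange (D := Type u))

end Square

open scoped TwoSquare in
/-- The five properties of a class `Q` of squares, where the last one is relative to a class `P`
of small categories. All classes of squares are taken to be stable under isomorphism. -/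
structure IsStableClass (P : ∀ (A : Type u) [SmallCategory A], Prop) (Q : Set Square.{u}) :
    Prop where
  of_isIsomorphic : ∀ {D E : Square.{u}}, D.IsIsomorphic E → D ∈ Q → E ∈ Q
  op : ∀ {D : Square.{u}}, D ∈ Q → D.op ∈ Q
  hComp : ∀ {C₁ C₂ C₃ C₄ C₅ C₆ : Type u} [SmallCategory C₁] [SmallCategory C₂]
    [SmallCategory C₃] [SmallCategory C₄] [SmallCategory C₅] [SmallCategory C₆]
    {T : C₁ ⥤ C₂} {L : C₁ ⥤ C₃} {R : C₂ ⥤ C₄} {B : C₃ ⥤ C₄}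
    {T₁ : C₂ ⥤ C₅} {R₁ : C₅ ⥤ C₆} {B₁ : C₄ ⥤ C₆}
    (σ : TwoSquare T L R B) (τ : TwoSquare T₁ R R₁ B₁),
    Square.of σ ∈ Q → Square.of τ ∈ Q → Square.of (σ ≫ₕ τ) ∈ Q
  /-- Local descent: `D` belongs to `Q` as soon as, for every object `y` of its lower left corner,
  the horizontal composite of `D` with the comma square on its left functor and on
  `y : e ⥤ bl` does. -/
  localDescent : ∀ D : Square.{u},
    (∀ y : D.bl, Square.of
      (Square.commaCell D.left (Functor.fromPUnit.{u} y) ≫ₕ D.cell) ∈ Q) → D ∈ Q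
  comma : ∀ {D : Square.{u}}, D.IsComma → D ∈ Q
  point : ∀ (A : Type u) [SmallCategory A], P A → Square.point A ∈ Q

end ExactSquares

namespace ExactSquares

/-! Exactness unfolds to the asphericity of one category for each arrow `g : R x ⟶ B y`
(`isExact_iff`). This form is self-dual because a category is aspherical iff its opposite is
(`isAspherical_op_iff`, via the twisted arrow category). Horizontal composition and local descent
are the two directions of one cancellation rule: if `F` is coaspherical, then `F ⋙ G` is
coaspherical iff `G` is (`isCoaspherical_comp_iff`). Comma squares are exact because they induce
left adjoints with invertible counit.

For minimality, local descent reduces to an exact square over the point. It factors as `toCommaCell`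
followed by a comma square, and the first factor is again exact. Both right-hand sides of this
factor are points below, so local descent applied to its opposite only meets squares of the form
`Square.point A`, with `A` aspherical by exactness.

For `wZero`, aspherical means connected. Base change evaluated at representables is computed by
pointwise colimits, and its invertibility says that the same categories are connected. -/

lemma elements_snd_w {A : Type u} [SmallCategory A] {b : A}
    {z w : CostructuredArrow
      (CategoryOfElements.π (Functor.hom A) ⋙ CategoryTheory.Prod.snd Aᵒᵖ A) b} (f : z ⟶ w) :
    (f.left.1.1.unop ≫ z.left.2 ≫ z.hom : w.left.1.1.unop ⟶ b) = w.left.2 ≫ w.hom := by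
  have h₁ : f.left.1.1.unop ≫ z.left.2 ≫ f.left.1.2 = w.left.2 := f.left.2
  have h₂ : f.left.1.2 ≫ w.hom = z.hom := CostructuredArrow.w f
  have h₃ : f.left.1.1.unop ≫ z.left.2 ≫ f.left.1.2 ≫ w.hom =
      (f.left.1.1.unop ≫ z.left.2 ≫ f.left.1.2) ≫ w.hom :=
    ((Category.assoc f.left.1.1.unop (z.left.2 ≫ f.left.1.2) w.hom).trans
      (congrArg (f.left.1.1.unop ≫ ·) (Category.assoc z.left.2 f.left.1.2 w.hom))).symm
  exact (congrArg (f.left.1.1.unop ≫ z.left.2 ≫ ·) h₂.symm).trans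
    (h₃.trans (congrArg (· ≫ w.hom) h₁))

lemma elements_fst_w {A : Type u} [SmallCategory A] {b : Aᵒᵖ}
    {z w : CostructuredArrow
      (CategoryOfElements.π (Functor.hom A) ⋙ CategoryTheory.Prod.fst Aᵒᵖ A) b} (f : z ⟶ w) :
    ((z.hom.unop ≫ z.left.2) ≫ f.left.1.2 : b.unop ⟶ w.left.1.2) = w.hom.unop ≫ w.left.2 := by
  have h₁ : f.left.1.1.unop ≫ z.left.2 ≫ f.left.1.2 = w.left.2 := f.left.2
  have h₂ : w.hom.unop ≫ f.left.1.1.unop = z.hom.unop :=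
    congrArg Quiver.Hom.unop (CostructuredArrow.w f)
  have h₃ : ((w.hom.unop ≫ f.left.1.1.unop) ≫ z.left.2) ≫ f.left.1.2 =
      w.hom.unop ≫ f.left.1.1.unop ≫ z.left.2 ≫ f.left.1.2 :=
    (Category.assoc (w.hom.unop ≫ f.left.1.1.unop) z.left.2 f.left.1.2).trans
      (Category.assoc w.hom.unop f.left.1.1.unop (z.left.2 ≫ f.left.1.2))
  exact (congrArg (fun t ↦ (t ≫ z.left.2) ≫ f.left.1.2) h₂.symm).trans
    (h₃.trans (congrArg (w.hom.unop ≫ ·) h₁))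

/-! ### Consequences of the axioms: slices, adjoints, homotopies. -/

namespace IsWeakFundamentalLocalizer

variable {W : MorphismProperty Cat.{u, u}} (hW : IsWeakFundamentalLocalizer W)

include hW

lemma comp_iff_right {A B C : Type u} [SmallCategory A] [SmallCategory B] [SmallCategory C]
    {F : A ⥤ B} (hF : W F.toCatHom) (G : B ⥤ C) : W (F ⋙ G).toCatHom ↔ W G.toCatHom := by
  have := hW.twoOutOfThree
  exact ⟨W.of_precomp F.toCatHom G.toCatHom hF, W.comp_mem F.toCatHom G.toCatHom hF⟩

lemma comp_iff_left {A B C : Type u} [SmallCategory A] [SmallCategory B] [SmallCategory C]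
    (F : A ⥤ B) {G : B ⥤ C} (hG : W G.toCatHom) : W (F ⋙ G).toCatHom ↔ W F.toCatHom := by
  have := hW.twoOutOfThree
  exact ⟨W.of_postcomp F.toCatHom G.toCatHom hG, fun hF ↦ W.comp_mem F.toCatHom G.toCatHom hF hG⟩

lemma id_mem (A : Type u) [SmallCategory A] : W (𝟭 A).toCatHom :=
  have := hW.containsIdentities
  W.id_mem (Cat.of A)

lemma isAspherical_iff_of_mem {A B : Type u} [SmallCategory A] [SmallCategory B] {F : A ⥤ B}
    (hF : W F.toCatHom) : IsAspherical W A ↔ IsAspherical W B :=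
  hW.comp_iff_right hF (Functor.star B)

lemma mem_iff_of_isAspherical {A B : Type u} [SmallCategory A] [SmallCategory B] (F : A ⥤ B)
    (hB : IsAspherical W B) : W F.toCatHom ↔ IsAspherical W A :=
  (hW.comp_iff_left F hB).symm

/-- Quillen's Theorem A: each `Over b` has a terminal object, so the relative condition on slices
becomes an absolute one. -/
lemma mem_of_isAspherical_costructuredArrow {A B : Type u} [SmallCategory A] [SmallCategory B]
    (F : A ⥤ B) (hF : ∀ b, IsAspherical W (CostructuredArrow F b)) : W F.toCatHom :=
  hW.of_over F fun b ↦
    (hW.mem_iff_of_isAspherical _ (hW.aspherical_of_hasTerminal (Over b))).2 (hF b)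

lemma mem_of_isLeftAdjoint {A B : Type u} [SmallCategory A] [SmallCategory B]
    (F : A ⥤ B) [F.IsLeftAdjoint] : W F.toCatHom := by
  refine hW.mem_of_isAspherical_costructuredArrow F fun b ↦ ?_
  have := isLeftAdjoint_iff_hasTerminal_costructuredArrow.1 (inferInstance : F.IsLeftAdjoint) b
  exact hW.aspherical_of_hasTerminal _

lemma isAspherical_iff_of_equivalence {A B : Type u} [SmallCategory A] [SmallCategory B]
    (F : A ≌ B) : IsAspherical W A ↔ IsAspherical W B :=
  hW.isAspherical_iff_of_mem (hW.mem_of_isLeftAdjoint F.functor)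

/-- The functor sending an object to its identity arrow belongs to any weak fundamental
localizer. -/
lemma arrow_id_mem (B : Type u) [SmallCategory B] :
    W (Functor.toCatHom
      ({ obj b := Arrow.mk (𝟙 b), map f := Arrow.homMk f f } : B ⥤ Arrow B)) := by
  let s : B ⥤ Arrow B := { obj b := Arrow.mk (𝟙 b), map f := Arrow.homMk f f }
  let adj : s ⊣ Arrow.leftFunc := Adjunction.mkOfHomEquiv
    { homEquiv b f :=
        { toFun φ := φ.left
          invFun φ := Arrow.homMk φ (φ ≫ f.hom) (Category.id_comp (φ ≫ f.hom)).symm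
          left_inv φ := by
            ext
            · rfl
            · exact (Arrow.w φ).trans (Category.id_comp φ.right)
          right_inv φ := rfl }
      homEquiv_naturality_left_symm φ g := by
        ext
        · rfl
        · exact Category.assoc φ g _
      homEquiv_naturality_right φ g := rfl }
  have : s.IsLeftAdjoint := adj.isLeftAdjoint
  exact hW.mem_of_isLeftAdjoint s

/-- A natural transformation is a functor to `Arrow B`. The source and target functors lie in `W`,
being retractions of the identity-arrow functor. -/
lemma mem_iff_of_natTrans {A B : Type u} [SmallCategory A] [SmallCategory B] {F G : A ⥤ B}
    (α : F ⟶ G) : W F.toCatHom ↔ W G.toCatHom := by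
  let H : A ⥤ Arrow B :=
    { obj a := Arrow.mk (α.app a), map f := Arrow.homMk (F.map f) (G.map f) }
  have h₁ : W (Arrow.leftFunc : Arrow B ⥤ B).toCatHom :=
    (hW.comp_iff_right (hW.arrow_id_mem B) _).1 (hW.id_mem B)
  have h₂ : W (Arrow.rightFunc : Arrow B ⥤ B).toCatHom :=
    (hW.comp_iff_right (hW.arrow_id_mem B) _).1 (hW.id_mem B)
  exact (hW.comp_iff_left H h₁).trans (hW.comp_iff_left H h₂).symm

/-- The two homotopies put the constant endofunctor at `x` in `W`; it factors through the point, so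
the retraction axiom applies. -/
lemma isAspherical_of_contraction {A : Type u} [SmallCategory A] (x : A) {r : A ⥤ A}
    (α : 𝟭 A ⟶ r) (β : (Functor.const A).obj x ⟶ r) : IsAspherical W A :=
  hW.of_retraction (Functor.fromPUnit.{u} x).toCatHom (Functor.star.{u} A).toCatHom
    (congrArg Functor.toCatHom (Functor.punit_ext' _ _))
    ((hW.mem_iff_of_natTrans β).2 ((hW.mem_iff_of_natTrans α).1 (hW.id_mem A)))

lemma isAspherical_of_hasInitial (A : Type u) [SmallCategory A] [HasInitial A] :
    IsAspherical W A :=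
  hW.isAspherical_of_contraction (⊥_ A) (𝟙 (𝟭 A)) { app := fun a ↦ initial.to a }

/-! ### Asphericity of the opposite category -/

lemma isAspherical_costructuredArrow_elements_snd {A : Type u} [SmallCategory A] (b : A) :
    IsAspherical W (CostructuredArrow
      (CategoryOfElements.π (Functor.hom A) ⋙ CategoryTheory.Prod.snd Aᵒᵖ A) b) := by
  let P := CategoryOfElements.π (Functor.hom A) ⋙ CategoryTheory.Prod.snd Aᵒᵖ A
  -- An object is an arrow `x ⟶ y` with a map `y ⟶ b`. It is pushed forward to the composite `x ⟶
  -- b`, which in turn receives a map from the identity of `b`.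
  let r : CostructuredArrow P b ⥤ CostructuredArrow P b :=
    { obj z := CostructuredArrow.mk
        (Y := Functor.elementsMk (Functor.hom A) (z.left.1.1, b) (z.left.2 ≫ z.hom)) (𝟙 b)
      map {z w} f := CostructuredArrow.homMk
        (CategoryOfElements.homMk _ _ (f.left.1.1, 𝟙 b) (by
          change f.left.1.1.unop ≫ (z.left.2 ≫ z.hom) ≫ 𝟙 b = w.left.2 ≫ w.hom
          rw [Category.comp_id]
          exact elements_snd_w f)) (Category.id_comp (𝟙 b))
      map_comp f g := by
        ext
        · rfl
        · exact (Category.comp_id (𝟙 b)).symm }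
  exact hW.isAspherical_of_contraction
    (CostructuredArrow.mk (Y := Functor.elementsMk (Functor.hom A) (Opposite.op b, b) (𝟙 b)) (𝟙 b))
    (r := r)
    { app z := CostructuredArrow.homMk (CategoryOfElements.homMk _ _ (𝟙 _, z.hom)
        (Category.id_comp (z.left.2 ≫ z.hom))) (Category.comp_id z.hom)
      naturality z w f := by
        ext
        · exact (Category.comp_id _).trans (Category.id_comp _).symm
        · exact (CostructuredArrow.w f).trans (Category.comp_id z.hom).symm }
    { app z := CostructuredArrow.homMk
        (CategoryOfElements.homMk _ _ ((z.left.2 ≫ z.hom).op, 𝟙 b) (by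
          change (z.left.2 ≫ z.hom) ≫ 𝟙 b ≫ 𝟙 b = z.left.2 ≫ z.hom
          simp)) (Category.id_comp (𝟙 b))
      naturality z w f := by
        ext
        swap; · rfl
        refine Quiver.Hom.unop_inj ?_
        change (w.left.2 ≫ w.hom) ≫ 𝟙 b = f.left.1.1.unop ≫ z.left.2 ≫ z.hom
        rw [Category.comp_id]
        exact (elements_snd_w f).symm }

lemma isAspherical_costructuredArrow_elements_fst {A : Type u} [SmallCategory A] (b : Aᵒᵖ) :
    IsAspherical W (CostructuredArrow
      (CategoryOfElements.π (Functor.hom A) ⋙ CategoryTheory.Prod.fst Aᵒᵖ A) b) := by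
  let P := CategoryOfElements.π (Functor.hom A) ⋙ CategoryTheory.Prod.fst Aᵒᵖ A
  let r : CostructuredArrow P b ⥤ CostructuredArrow P b :=
    { obj z := CostructuredArrow.mk
        (Y := Functor.elementsMk (Functor.hom A) (b, z.left.1.2) (z.hom.unop ≫ z.left.2)) (𝟙 b)
      map {z w} f := CostructuredArrow.homMk
        (CategoryOfElements.homMk _ _ (𝟙 b, f.left.1.2) (by
          change 𝟙 b.unop ≫ (z.hom.unop ≫ z.left.2) ≫ f.left.1.2 = w.hom.unop ≫ w.left.2
          rw [Category.id_comp]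
          exact elements_fst_w f)) (Category.id_comp (𝟙 b))
      map_comp f g := by
        ext
        · exact (Category.comp_id (𝟙 b)).symm
        · rfl }
  exact hW.isAspherical_of_contraction
    (CostructuredArrow.mk
      (Y := Functor.elementsMk (Functor.hom A) (b, b.unop) (𝟙 b.unop)) (𝟙 b))
    (r := r)
    { app z := CostructuredArrow.homMk (CategoryOfElements.homMk _ _ (z.hom, 𝟙 _)
        (congrArg (z.hom.unop ≫ ·) (Category.comp_id z.left.2))) (Category.comp_id z.hom)
      naturality z w f := by
        ext
        · exact (CostructuredArrow.w f).trans (Category.comp_id z.hom).symm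
        · exact (Category.comp_id _).trans (Category.id_comp _).symm }
    { app z := CostructuredArrow.homMk
        (CategoryOfElements.homMk _ _ (𝟙 b, z.hom.unop ≫ z.left.2) (by
          change 𝟙 b.unop ≫ 𝟙 b.unop ≫ z.hom.unop ≫ z.left.2 = z.hom.unop ≫ z.left.2
          simp)) (Category.id_comp (𝟙 b))
      naturality z w f := by
        ext
        · rfl
        change 𝟙 b.unop ≫ w.hom.unop ≫ w.left.2 = (z.hom.unop ≫ z.left.2) ≫ f.left.1.2
        rw [Category.id_comp]
        exact (elements_fst_w f).symm }

/-- The category of elements of the hom functor is the twisted arrow category; both its projections,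
to `Aᵒᵖ` and to `A`, lie in `W`. -/
lemma isAspherical_op_iff (A : Type u) [SmallCategory A] :
    IsAspherical W Aᵒᵖ ↔ IsAspherical W A :=
  (hW.isAspherical_iff_of_mem (hW.mem_of_isAspherical_costructuredArrow
      (CategoryOfElements.π (Functor.hom A) ⋙ CategoryTheory.Prod.fst Aᵒᵖ A)
      hW.isAspherical_costructuredArrow_elements_fst)).symm.trans
    (hW.isAspherical_iff_of_mem (hW.mem_of_isAspherical_costructuredArrow
      (CategoryOfElements.π (Functor.hom A) ⋙ CategoryTheory.Prod.snd Aᵒᵖ A)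
      hW.isAspherical_costructuredArrow_elements_snd))

/-! ### Coaspherical functors -/

lemma isCoaspherical_iff {A B : Type u} [SmallCategory A] [SmallCategory B] (F : A ⥤ B) :
    IsCoaspherical W F ↔ ∀ b, IsAspherical W (StructuredArrow b F) :=
  forall_congr' fun b ↦ hW.mem_iff_of_isAspherical _ (hW.isAspherical_of_hasInitial (Under b))

lemma isCoaspherical_of_isRightAdjoint {A B : Type u} [SmallCategory A] [SmallCategory B]
    (F : A ⥤ B) [F.IsRightAdjoint] : IsCoaspherical W F := by
  refine (hW.isCoaspherical_iff F).2 fun b ↦ ?_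
  have := isRightAdjoint_iff_hasInitial_structuredArrow.1 (inferInstance : F.IsRightAdjoint) b
  exact hW.isAspherical_of_hasInitial _

/-- The slices of `F.op` are opposites of the coslices of `F`, so Theorem A applies to `F.op`. -/
lemma isAspherical_iff_of_isCoaspherical {A B : Type u} [SmallCategory A] [SmallCategory B]
    {F : A ⥤ B} (hF : IsCoaspherical W F) : IsAspherical W A ↔ IsAspherical W B := by
  rw [← hW.isAspherical_op_iff A, ← hW.isAspherical_op_iff B]
  refine hW.isAspherical_iff_of_mem (hW.mem_of_isAspherical_costructuredArrow F.op fun b ↦ ?_)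
  rw [← hW.isAspherical_iff_of_equivalence (structuredArrowOpEquivalence F b.unop),
    hW.isAspherical_op_iff]
  exact (hW.isCoaspherical_iff F).1 hF _

/-- The functor induced on coslices under `c` is itself coaspherical, since its own coslices are
equivalent to coslices of `F`. -/
lemma isCoaspherical_comp_iff {A B C : Type u} [SmallCategory A] [SmallCategory B]
    [SmallCategory C] {F : A ⥤ B} (hF : IsCoaspherical W F) (G : B ⥤ C) :
    IsCoaspherical W (F ⋙ G) ↔ IsCoaspherical W G := by
  rw [hW.isCoaspherical_iff, hW.isCoaspherical_iff]
  refine forall_congr' fun c ↦ hW.isAspherical_iff_of_isCoaspherical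
    (F := StructuredArrow.pre c F G) ((hW.isCoaspherical_iff _).2 fun z ↦ ?_)
  rw [hW.isAspherical_iff_of_equivalence (StructuredArrow.preEquivalence F z)]
  exact (hW.isCoaspherical_iff F).1 hF _

lemma isCoaspherical_of_comp_isEquivalence {A B C : Type u} [SmallCategory A] [SmallCategory B]
    [SmallCategory C] (F : A ⥤ B) (G : B ⥤ C) [G.IsEquivalence]
    (h : IsCoaspherical W (F ⋙ G)) : IsCoaspherical W F := by
  rw [hW.isCoaspherical_iff] at h ⊢
  intro b
  rw [hW.isAspherical_iff_of_equivalence (StructuredArrow.post b F G).asEquivalence]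
  exact h _

lemma isCoaspherical_iff_of_iso {A B : Type u} [SmallCategory A] [SmallCategory B] {F G : A ⥤ B}
    (e : F ≅ G) : IsCoaspherical W F ↔ IsCoaspherical W G := by
  rw [hW.isCoaspherical_iff, hW.isCoaspherical_iff]
  exact forall_congr' fun b ↦ hW.isAspherical_iff_of_equivalence (StructuredArrow.mapNatIso e)

end IsWeakFundamentalLocalizer

namespace IsWeakFundamentalLocalizer

variable {W : MorphismProperty Cat.{u, u}} (hW : IsWeakFundamentalLocalizer W)

include hW

/-- The unit moves `z ⟶ F a` to `z ⟶ F G F a`, which receives a map from the inverse counit `z ⟶ F G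
z`; this contracts the coslice under `z`. -/
lemma isCoaspherical_of_adjunction {A B : Type u} [SmallCategory A] [SmallCategory B]
    {F : A ⥤ B} {G : B ⥤ A} (adj : F ⊣ G) [IsIso adj.counit] : IsCoaspherical W F := by
  refine (hW.isCoaspherical_iff F).2 fun z ↦ ?_
  let r : StructuredArrow z F ⥤ StructuredArrow z F :=
    { obj f := StructuredArrow.mk (f.hom ≫ F.map (adj.unit.app f.right))
      map {f g} φ := StructuredArrow.homMk (G.map (F.map φ.right)) (by
        dsimp
        rw [Category.assoc, ← F.map_comp, adj.unit_naturality, F.map_comp,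
          StructuredArrow.w_assoc]) }
  exact hW.isAspherical_of_contraction (StructuredArrow.mk (inv (adj.counit.app z))) (r := r)
    { app f := StructuredArrow.homMk (adj.unit.app f.right) }
    { app f := StructuredArrow.homMk (G.map f.hom) (by
        have := adj.left_triangle_components f.right
        simp [r, ← cancel_mono (adj.counit.app (F.obj f.right))])
      naturality f g φ := by
        ext
        simp [r, ← Functor.map_comp] }

end IsWeakFundamentalLocalizer

namespace Square

/-! ### Comma squares of functors -/

section

variable {C₂ C₃ C₄ : Type u} [SmallCategory C₂] [SmallCategory C₃] [SmallCategory C₄]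
  (R : C₂ ⥤ C₄) (B : C₃ ⥤ C₄) (y : C₃)

/-- The functor `C₂/(B y) ⥤ (R ↓ B)/y` right adjoint to the functor induced by the comma
square. -/
@[simps]
def commaCellSection :
    CostructuredArrow R (B.obj y) ⥤ CostructuredArrow (Comma.snd R B) y where
  obj f := CostructuredArrow.mk (S := Comma.snd R B)
    (Y := ({ left := f.left, right := y, hom := f.hom } : Comma R B)) (𝟙 y)
  map φ := CostructuredArrow.homMk { left := φ.left, right := 𝟙 y } (Category.id_comp (𝟙 y))

/-- The adjunction between `(R ↓ B)/y ⥤ C₂/(B y)` and `commaCellSection`. -/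
def commaCellAdjunction :
    (commaCell R B).costructuredArrowRightwards y ⊣ commaCellSection R B y :=
  Adjunction.mkOfUnitCounit
    { unit :=
        { app f := CostructuredArrow.homMk
            { left := 𝟙 _
              right := f.hom
              w := (congrArg (· ≫ f.left.hom ≫ B.map f.hom) (R.map_id f.left.left)).trans
                (Category.id_comp _) } (Category.comp_id f.hom)
          naturality f g φ := by
            ext
            · exact (Category.comp_id _).trans (Category.id_comp _).symm
            · exact (CostructuredArrow.w φ).trans (Category.comp_id f.hom).symm }
      counit :=
        { app f := CostructuredArrow.homMk (𝟙 f.left) (by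
            change R.map (𝟙 f.left) ≫ f.hom = f.hom ≫ B.map (𝟙 y)
            simp)
          naturality f g φ := by
            ext
            exact (Category.comp_id _).trans (Category.id_comp _).symm }
      left_triangle := by
        ext f
        change 𝟙 f.left.left ≫ 𝟙 f.left.left ≫ 𝟙 f.left.left = 𝟙 f.left.left
        simp
      right_triangle := by
        ext f
        · change 𝟙 f.left ≫ 𝟙 f.left ≫ 𝟙 f.left = 𝟙 f.left
          simp
        · change 𝟙 y ≫ 𝟙 y ≫ 𝟙 y = 𝟙 y
          simp }

instance : IsIso (commaCellAdjunction R B y).counit := by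
  have (f : CostructuredArrow R (B.obj y)) :
      IsIso ((commaCellAdjunction R B y).counit.app f) := by
    have : IsIso ((CostructuredArrow.proj R (B.obj y)).map
        ((commaCellAdjunction R B y).counit.app f)) :=
      inferInstanceAs (IsIso (𝟙 f.left))
    exact isIso_of_reflects_iso _ (CostructuredArrow.proj R (B.obj y))
  exact NatIso.isIso_of_isIso_app _

/-- Over the point every structure map `f.hom` is invertible, hence so is the unit. -/
lemma isEquivalence_commaCell (B : Pt.{u} ⥤ C₄) (y : Pt.{u}) :
    ((commaCell R B).costructuredArrowRightwards y).IsEquivalence := by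
  let adj := commaCellAdjunction R B y
  have (f : CostructuredArrow (Comma.snd R B) y) :
      IsIso (adj.unit.app f) := by
    let e : f.left ≅ (((commaCell R B).costructuredArrowRightwards y ⋙
        commaCellSection R B y).obj f).left :=
      Comma.isoMk (Iso.refl f.left.left) (asIso f.hom) (adj.unit.app f).left.w
    have : IsIso ((CostructuredArrow.proj _ y).map (adj.unit.app f)) := e.isIso_hom
    exact isIso_of_reflects_iso _ (CostructuredArrow.proj _ y)
  have (f : _) : IsIso (adj.counit.app f) := inferInstance
  exact adj.toEquivalence.isEquivalence_functor

end

end Square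

open Square

open scoped TwoSquare

/-! ### Stability properties of exact squares. -/

namespace IsWeakFundamentalLocalizer

variable {W : MorphismProperty Cat.{u, u}} (hW : IsWeakFundamentalLocalizer W)

include hW

lemma isExact_iff (D : Square.{u}) : D.IsExact W ↔
    ∀ (x : D.tr) (y : D.bl) (g : D.right.obj x ⟶ D.bottom.obj y),
      IsAspherical W (D.cell.StructuredArrowRightwards g) := by
  refine ⟨fun h x y g ↦ (hW.isCoaspherical_iff _).1 (h y) _, fun h y ↦
    (hW.isCoaspherical_iff _).2 fun z ↦ ?_⟩
  obtain ⟨x, g, rfl⟩ := z.mk_surjective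
  exact h x y g

lemma isExact_op {D : Square.{u}} (hD : D.IsExact W) : D.op.IsExact W := by
  refine (hW.isExact_iff _).2 fun x y g ↦ ?_
  exact (hW.isAspherical_op_iff _).1 ((hW.isAspherical_iff_of_equivalence
    (D.cell.structuredArrowRightwardsOpEquivalence g)).2
      ((hW.isAspherical_iff_of_equivalence (D.cell.equivalenceJ g.unop)).1
        ((hW.isExact_iff D).1 hD _ _ _)))

section

variable {C₁ C₂ C₃ C₄ C₅ C₆ : Type u} [SmallCategory C₁] [SmallCategory C₂]
    [SmallCategory C₃] [SmallCategory C₄] [SmallCategory C₅] [SmallCategory C₆]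
    {T : C₁ ⥤ C₂} {L : C₁ ⥤ C₃} {R : C₂ ⥤ C₄} {B : C₃ ⥤ C₄}
    {T₁ : C₂ ⥤ C₅} {R₁ : C₅ ⥤ C₆} {B₁ : C₄ ⥤ C₆}
    (σ : TwoSquare T L R B) (τ : TwoSquare T₁ R R₁ B₁)

lemma isCoaspherical_hComp_iff (y : C₃) :
    IsCoaspherical W ((σ ≫ₕ τ).costructuredArrowRightwards y) ↔
      IsCoaspherical W (σ.costructuredArrowRightwards y ⋙
        τ.costructuredArrowRightwards (B.obj y)) :=
  (hW.isCoaspherical_iff_of_iso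
    (TwoSquare.GuitartExact.costructuredArrowRightwardsComp σ τ y)).symm

lemma isExact_hComp (hσ : (Square.of σ).IsExact W) (hτ : (Square.of τ).IsExact W) :
    (Square.of (σ ≫ₕ τ)).IsExact W := fun y ↦
  (hW.isCoaspherical_hComp_iff σ τ y).2 ((hW.isCoaspherical_comp_iff (hσ y) _).2 (hτ _))

end

lemma isExact_of_isIsomorphic {D E : Square.{u}} (h : D.IsIsomorphic E) (hD : D.IsExact W) :
    E.IsExact W := by
  obtain ⟨i₁, i₂, i₃, i₄, hT, hL, hR, hB, hc⟩ := h
  have h₁ : i₁.hom.toFunctor.IsEquivalence := (Cat.equivOfIso i₁).isEquivalence_functor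
  have h₂ : i₂.hom.toFunctor.IsEquivalence := (Cat.equivOfIso i₂).isEquivalence_functor
  have h₃ : i₃.hom.toFunctor.IsEquivalence := (Cat.equivOfIso i₃).isEquivalence_functor
  have h₄ : i₄.hom.toFunctor.IsEquivalence := (Cat.equivOfIso i₄).isEquivalence_functor
  generalize hI₁ : i₁.hom.toFunctor = I₁ at *
  generalize hI₂ : i₂.hom.toFunctor = I₂ at *
  generalize hI₄ : i₄.hom.toFunctor = I₄ at *
  intro y
  obtain ⟨y, rfl⟩ : ∃ y₀, i₃.hom.toFunctor.obj y₀ = y :=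
    ⟨i₃.inv.toFunctor.obj y, congrArg (fun F : E.bl ⟶ E.bl ↦ F.toFunctor.obj y) i₃.inv_hom_id⟩
  generalize i₃.hom.toFunctor = I₃ at *
  have := (Comma.mapLeftIso (Functor.fromPUnit.{0} (I₃.obj y)) (eqToIso hL)).isEquivalence_functor
  have := CostructuredArrow.isEquivalence_pre I₁ E.left (I₃.obj y)
  have := CostructuredArrow.isEquivalence_post y D.left I₃
  have := (Comma.mapLeftIso (Functor.fromPUnit.{0} (I₄.obj (D.bottom.obj y)))
    (eqToIso hR)).isEquivalence_functor
  have hP : IsCoaspherical W (CostructuredArrow.post D.left I₃ y ⋙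
      (Comma.mapLeftIso _ (eqToIso hL)).functor ⋙
      CostructuredArrow.pre I₁ E.left (I₃.obj y)) :=
    hW.isCoaspherical_of_isRightAdjoint _
  have := CostructuredArrow.isEquivalence_pre I₂ E.right (I₄.obj (D.bottom.obj y))
  have := CostructuredArrow.isEquivalence_post (D.bottom.obj y) D.right I₄
  have hQ : IsCoaspherical W (CostructuredArrow.post D.right I₄ (D.bottom.obj y) ⋙
      (Comma.mapLeftIso _ (eqToIso hR)).functor ⋙
      CostructuredArrow.pre I₂ E.right (I₄.obj (D.bottom.obj y)) ⋙
      (CostructuredArrow.mapIso (eqToIso (Functor.congr_obj hB y))).functor) :=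
    hW.isCoaspherical_of_isRightAdjoint _
  -- The equivalences of slices in `hP` and `hQ` intertwine the functors attached to `D` and `E` up
  -- to a natural isomorphism, constructed next.
  refine (hW.isCoaspherical_comp_iff hP _).1 ((hW.isCoaspherical_iff_of_iso ?_).1
    ((hW.isCoaspherical_comp_iff (hD y) _).2 hQ))
  refine NatIso.ofComponents
    (fun f ↦ CostructuredArrow.isoMk (eqToIso (Functor.congr_obj hT f.left)) ?_) ?_
  · have h₁ : I₄.map (D.cell.natTrans.app f.left) =
        eqToHom (Functor.congr_obj hR (D.top.obj f.left) |>.trans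
          (congrArg E.right.obj (Functor.congr_obj hT f.left))) ≫
        E.cell.natTrans.app (I₁.obj f.left) ≫
        eqToHom ((Functor.congr_obj hB (D.left.obj f.left)).trans
          (congrArg E.bottom.obj (Functor.congr_obj hL f.left))).symm :=
      (conj_eqToHom_iff_heq' _ _ _ _).2 (hc _)
    have h₂ := Functor.congr_hom hB f.hom
    dsimp at h₂
    change E.right.map (eqToHom (Functor.congr_obj hT f.left)) ≫
        E.cell.natTrans.app (I₁.obj f.left) ≫
        E.bottom.map ((eqToIso hL).inv.app f.left ≫ I₃.map f.hom) =
      ((eqToIso hR).inv.app (D.top.obj f.left) ≫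
        I₄.map (D.cell.natTrans.app f.left ≫ D.bottom.map f.hom)) ≫
        eqToHom (Functor.congr_obj hB y)
    simp [h₁, h₂, eqToHom_map, eqToHom_app]
  · intro f g φ
    ext
    have := Functor.congr_hom hT φ.left
    dsimp at this
    change I₂.map (D.top.map φ.left) ≫ eqToHom (Functor.congr_obj hT g.left) =
      eqToHom (Functor.congr_obj hT f.left) ≫ E.top.map (I₁.map φ.left)
    simp [this]

lemma isExact_commaCell {C₂ C₃ C₄ : Type u} [SmallCategory C₂] [SmallCategory C₃]
    [SmallCategory C₄] (R : C₂ ⥤ C₄) (B : C₃ ⥤ C₄) : (Square.of (commaCell R B)).IsExact W :=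
  fun y ↦ by
  change C₃ at y
  have := hW.isCoaspherical_of_adjunction (commaCellAdjunction R B y)
  exact this

end IsWeakFundamentalLocalizer

lemma Square.IsComma.isIsomorphic {D : Square.{u}} (hD : D.IsComma) :
    (Square.of (commaCell D.right D.bottom)).IsIsomorphic D := by
  have : IsIso D.toComma.toCatHom := hD
  have h : (inv D.toComma.toCatHom).toFunctor ⋙ D.toComma = 𝟭 _ :=
    congrArg Cat.Hom.toFunctor (IsIso.inv_hom_id D.toComma.toCatHom)
  have key (x y : Comma D.right D.bottom) (hxy : x = y) : HEq x.hom y.hom := by rw [hxy]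
  exact ⟨(asIso D.toComma.toCatHom).symm, Iso.refl _, Iso.refl _, Iso.refl _,
    congrArg (· ⋙ Comma.fst _ _) h.symm, congrArg (· ⋙ Comma.snd _ _) h.symm, rfl, rfl,
    fun x ↦ key _ _ (Functor.congr_obj h.symm x)⟩

namespace IsWeakFundamentalLocalizer

variable {W : MorphismProperty Cat.{u, u}} (hW : IsWeakFundamentalLocalizer W)

include hW

lemma isExact_of_isComma {D : Square.{u}} (hD : D.IsComma) : D.IsExact W :=
  hW.isExact_of_isIsomorphic hD.isIsomorphic (hW.isExact_commaCell _ _)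

lemma isExact_localDescent (D : Square.{u})
    (hD : ∀ y : D.bl, (Square.of
      (Square.commaCell D.left (Functor.fromPUnit.{u} y) ≫ₕ D.cell)).IsExact W) :
    D.IsExact W := by
  intro y
  have := (hW.isCoaspherical_hComp_iff _ _ _).1 (hD y ⟨⟨⟩⟩)
  exact (hW.isCoaspherical_comp_iff (hW.isExact_commaCell _ _ _) _).1 this

lemma isExact_point_iff (A : Type u) [SmallCategory A] :
    (Square.point A).IsExact W ↔ IsAspherical W A := by
  let σ : TwoSquare (Functor.star.{u} A) (Functor.star.{u} A) (𝟭 Pt.{u}) (𝟭 Pt.{u}) := 𝟙 _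
  have key (x y : Pt.{u}) (g : (𝟭 Pt.{u}).obj x ⟶ (𝟭 Pt.{u}).obj y) :
      IsAspherical W (σ.StructuredArrowRightwards g) ↔ IsAspherical W A := by
    let F : σ.StructuredArrowRightwards g ⥤ A :=
      StructuredArrow.proj _ _ ⋙ CostructuredArrow.proj _ _
    have : F.Full := ⟨fun {z w} f ↦
      ⟨StructuredArrow.homMk (CostructuredArrow.homMk f (Subsingleton.elim _ _))
        (by ext; exact Subsingleton.elim (α := (_ : Pt) ⟶ _) _ _), rfl⟩⟩
    have : F.Faithful := inferInstance
    have : F.EssSurj := ⟨fun a ↦ ⟨TwoSquare.StructuredArrowRightwards.mk _ _ a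
      (Discrete.eqToHom (Subsingleton.elim _ _)) (Discrete.eqToHom (Subsingleton.elim _ _))
      (Subsingleton.elim _ _), ⟨Iso.refl _⟩⟩⟩
    have : F.IsEquivalence := { }
    exact hW.isAspherical_iff_of_equivalence F.asEquivalence
  rw [hW.isExact_iff]
  exact ⟨fun h ↦ (key ⟨⟨⟩⟩ ⟨⟨⟩⟩ (𝟙 _)).1 (h _ _ _), fun h x y g ↦ (key x y g).2 h⟩

lemma isStableClass_isExact :
    IsStableClass (fun A _ ↦ IsAspherical W A) {D : Square.{u} | D.IsExact W} where
  of_isIsomorphic := hW.isExact_of_isIsomorphic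
  op := hW.isExact_op
  hComp := hW.isExact_hComp
  localDescent := hW.isExact_localDescent
  comma := hW.isExact_of_isComma
  point A _ hA := (hW.isExact_point_iff A).2 hA

end IsWeakFundamentalLocalizer

open Square

open scoped TwoSquare

/-! ### Minimality of the class of exact squares -/

namespace Square

lemma map_heq {C D : Type*} [Category* C] [Category* D] (F : C ⥤ D) {a b a' b' : C} (ha : a = a')
    (hb : b = b') {f : a ⟶ b} {g : a' ⟶ b'} (h : HEq f g) : HEq (F.map f) (F.map g) := by
  subst ha hb
  cases h
  rfl

lemma isoComp_eq {A B A' B' : Cat.{u, u}} (i : A ≅ A') (j : B ≅ B') {F : A ⥤ B} {G : A' ⥤ B'}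
    (h : F ⋙ j.hom.toFunctor = i.hom.toFunctor ⋙ G) :
    G ⋙ j.inv.toFunctor = i.inv.toFunctor ⋙ F := by
  let f : A ⟶ B := F.toCatHom
  let g : A' ⟶ B' := G.toCatHom
  have h' : f ≫ j.hom = i.hom ≫ g := congrArg Functor.toCatHom h
  have h'' : g ≫ j.inv = i.inv ≫ f := by
    rw [Iso.comp_inv_eq, Category.assoc, h', Iso.inv_hom_id_assoc]
  exact congrArg Cat.Hom.toFunctor h''

lemma IsIsomorphic.symm {D E : Square.{u}} (h : D.IsIsomorphic E) : E.IsIsomorphic D := by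
  obtain ⟨i₁, i₂, i₃, i₄, hT, hL, hR, hB, hc⟩ := h
  refine ⟨i₁.symm, i₂.symm, i₃.symm, i₄.symm, isoComp_eq _ _ hT, isoComp_eq _ _ hL,
    isoComp_eq _ _ hR, isoComp_eq _ _ hB, fun x ↦ ?_⟩
  have h₁ : i₁.hom.toFunctor.obj (i₁.inv.toFunctor.obj x) = x :=
    congrArg (fun F : E.tl ⟶ E.tl ↦ F.toFunctor.obj x) i₁.inv_hom_id
  have h₄ : i₄.hom.toFunctor ⋙ i₄.inv.toFunctor = 𝟭 _ := congrArg Cat.Hom.toFunctor i₄.hom_inv_id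
  have h₅ := (hc (i₁.inv.toFunctor.obj x)).trans (congr_arg_heq E.cell.natTrans.app h₁)
  have hs : i₄.hom.toFunctor.obj (D.right.obj (D.top.obj (i₁.inv.toFunctor.obj x))) =
      E.right.obj (E.top.obj x) := by
    have := (Functor.congr_obj hR (D.top.obj (i₁.inv.toFunctor.obj x))).trans
      (congrArg E.right.obj (Functor.congr_obj hT (i₁.inv.toFunctor.obj x)))
    exact this.trans (congrArg (fun a ↦ E.right.obj (E.top.obj a)) h₁)
  have ht : i₄.hom.toFunctor.obj (D.bottom.obj (D.left.obj (i₁.inv.toFunctor.obj x))) =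
      E.bottom.obj (E.left.obj x) := by
    have := (Functor.congr_obj hB (D.left.obj (i₁.inv.toFunctor.obj x))).trans
      (congrArg E.bottom.obj (Functor.congr_obj hL (i₁.inv.toFunctor.obj x)))
    exact this.trans (congrArg (fun a ↦ E.bottom.obj (E.left.obj a)) h₁)
  exact (map_heq i₄.inv.toFunctor hs ht h₅).symm.trans
    (Functor.hcongr_hom h₄ (D.cell.natTrans.app (i₁.inv.toFunctor.obj x)))

lemma isComma_commaCell {C₂ C₃ C₄ : Type u} [SmallCategory C₂] [SmallCategory C₃]
    [SmallCategory C₄] (R : C₂ ⥤ C₄) (B : C₃ ⥤ C₄) : (Square.of (commaCell R B)).IsComma :=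
  inferInstanceAs (IsIso (𝟙 (Cat.of (Comma R B))))

section

variable {C₁ C₂ C₃ C₄ : Type u} [SmallCategory C₁] [SmallCategory C₂] [SmallCategory C₃]
  [SmallCategory C₄] {T : C₁ ⥤ C₂} {L : C₁ ⥤ C₃} {R : C₂ ⥤ C₄} {B : C₃ ⥤ C₄}
  (σ : TwoSquare T L R B)

/-- The functor to the comma category induced by a square. -/
abbrev toCommaFunctor : C₁ ⥤ Comma R B := (Square.of σ).toComma

/-- The square whose horizontal composite with the comma square on the right and bottom functors
of `σ` is `σ`. -/
def toCommaCell : TwoSquare (toCommaFunctor σ) L (Comma.snd R B) (𝟭 C₃) :=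
  TwoSquare.mk _ _ _ _ (𝟙 L)

lemma toCommaCell_hComp_isIsomorphic :
    (Square.of (toCommaCell σ ≫ₕ commaCell R B)).IsIsomorphic (Square.of σ) := by
  refine ⟨Iso.refl _, Iso.refl _, Iso.refl _, Iso.refl _, rfl, rfl, rfl, rfl,
    fun (x : C₁) ↦ heq_of_eq ?_⟩
  change 𝟙 (R.obj (T.obj x)) ≫ σ.natTrans.app x ≫
    𝟙 (B.obj (L.obj x)) ≫ B.map (𝟙 (L.obj x)) ≫ 𝟙 (B.obj (L.obj x)) = σ.natTrans.app x
  rw [Category.id_comp, B.map_id]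
  exact (congrArg (σ.natTrans.app x ≫ ·) ((Category.id_comp _).trans (Category.id_comp _))).trans
    (Category.comp_id _)

end

/-- The isomorphism between a category and its double opposite. -/
def opOpIso (C : Cat.{u, u}) : Cat.of (Cᵒᵖ)ᵒᵖ ≅ C where
  hom := (unopUnop C).toCatHom
  inv := (opOp C).toCatHom

lemma op_op_isIsomorphic (D : Square.{u}) : D.op.op.IsIsomorphic D :=
  ⟨opOpIso _, opOpIso _, opOpIso _, opOpIso _, rfl, rfl, rfl, rfl, fun _ ↦ HEq.rfl⟩

lemma ptOp_ext {C : Type u} [SmallCategory C] (F G : C ⥤ Pt.{u}ᵒᵖ) : F = G :=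
  CategoryTheory.Functor.ext (fun _ ↦ Opposite.unop_injective (Subsingleton.elim (α := Pt.{u}) _ _))
    (fun _ _ _ ↦ Quiver.Hom.unop_inj (Subsingleton.elim _ _))

/-- The isomorphism between the point category and its opposite. -/
def ptOpIso : Cat.of Pt.{u} ≅ Cat.of Pt.{u}ᵒᵖ where
  hom := (Functor.fromPUnit.{u} (Opposite.op ⟨⟨⟩⟩)).toCatHom
  inv := (Functor.star.{u} Pt.{u}ᵒᵖ).toCatHom
  hom_inv_id := congrArg Functor.toCatHom (Functor.punit_ext' _ _)
  inv_hom_id := congrArg Functor.toCatHom (ptOp_ext _ _)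

/-- Passing to opposites turns point corners into `Ptᵒᵖ`; this identifies the squares then met in
local descent. -/
lemma point_isIsomorphic {X : Type u} [SmallCategory X] {T : X ⥤ Pt.{u}ᵒᵖ} {L : X ⥤ Pt.{u}}
    {R : Pt.{u}ᵒᵖ ⥤ Pt.{u}ᵒᵖ} {B : Pt.{u} ⥤ Pt.{u}ᵒᵖ} (σ : TwoSquare T L R B) :
    (Square.point X).IsIsomorphic (Square.of σ) :=
  ⟨Iso.refl _, ptOpIso, Iso.refl _, ptOpIso, ptOp_ext _ _, Functor.punit_ext' _ _,
    ptOp_ext _ _, ptOp_ext _ _,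
    fun _ ↦ heq_of_eq (Quiver.Hom.unop_inj (Subsingleton.elim (α := (_ : Pt.{u}) ⟶ _) _ _))⟩

end Square

namespace IsWeakFundamentalLocalizer

variable {W : MorphismProperty Cat.{u, u}} (hW : IsWeakFundamentalLocalizer W)

include hW

/-- An exact square whose lower left corner is the point category belongs to any class of squares
with the stability properties. -/
lemma mem_of_isExact_of_pt {Q : Set Square.{u}}
    (hQ : IsStableClass (fun A _ ↦ IsAspherical W A) Q)
    {C₁ C₂ C₄ : Type u} [SmallCategory C₁] [SmallCategory C₂] [SmallCategory C₄]
    {T : C₁ ⥤ C₂} {L : C₁ ⥤ Pt.{u}} {R : C₂ ⥤ C₄} {B : Pt.{u} ⥤ C₄} (σ : TwoSquare T L R B)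
    (hσ : (Square.of σ).IsExact W) : Square.of σ ∈ Q := by
  let τ := toCommaCell σ
  have hτ : (Square.of τ).IsExact W := fun (y : Pt.{u}) ↦ by
    have h := hW.isExact_of_isIsomorphic (toCommaCell_hComp_isIsomorphic σ).symm hσ
    -- An equivalence can be cancelled on the right, which general coaspherical functors do not
    -- allow here.
    have : ((commaCell R B).costructuredArrowRightwards ((𝟭 Pt.{u}).obj y)).IsEquivalence :=
      isEquivalence_commaCell R B y
    have hy := hW.isCoaspherical_of_comp_isEquivalence (τ.costructuredArrowRightwards y)
      ((commaCell R B).costructuredArrowRightwards ((𝟭 Pt.{u}).obj y))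
      ((hW.isCoaspherical_hComp_iff τ (commaCell R B) y).1 (h y))
    exact hy
  -- The lower left corner is now the opposite of the comma category; descent along its objects
  -- leaves three trivial corners.
  have hτ_op : (Square.of τ).op ∈ Q := hQ.localDescent _ fun z ↦ by
    have h := hW.isExact_hComp (commaCell (Square.of τ).op.left (Functor.fromPUnit.{u} z))
      (Square.of τ).op.cell (hW.isExact_commaCell _ _) (hW.isExact_op hτ)
    have e := point_isIsomorphic
      (commaCell (Square.of τ).op.left (Functor.fromPUnit.{u} z) ≫ₕ (Square.of τ).op.cell)
    exact hQ.of_isIsomorphic e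
      (hQ.point _ ((hW.isExact_point_iff _).1 (hW.isExact_of_isIsomorphic e.symm h)))
  exact hQ.of_isIsomorphic (toCommaCell_hComp_isIsomorphic σ)
    (hQ.hComp τ (commaCell R B)
      (hQ.of_isIsomorphic (Square.of τ).op_op_isIsomorphic (hQ.op hτ_op))
      (hQ.comma (isComma_commaCell R B)))

lemma isLeast_isExact :
    IsLeast {Q : Set Square.{u} | IsStableClass (fun A _ ↦ IsAspherical W A) Q}
      {D : Square.{u} | D.IsExact W} :=
  ⟨hW.isStableClass_isExact, fun _ hQ D hD ↦ hQ.localDescent D fun y ↦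
    hW.mem_of_isExact_of_pt hQ _
      (hW.isExact_hComp _ _ (hW.isExact_commaCell D.left (Functor.fromPUnit.{u} y)) hD)⟩

end IsWeakFundamentalLocalizer

/-! ### The localizer of functors bijective on connected components -/

lemma isConnected_iff_bijective_star (A : Type u) [SmallCategory A] :
    IsConnected A ↔ Function.Bijective (Functor.star.{u} A).mapConnectedComponents := by
  have hPt (x y : ConnectedComponents Pt.{u}) : x = y := by
    induction x using Quotient.inductionOn
    induction y using Quotient.inductionOn
    exact congrArg _ (Subsingleton.elim (α := Pt.{u}) _ _)
  constructor
  · intro h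
    refine ⟨fun x y _ ↦ ?_, fun y ↦ ⟨CategoryTheory.ConnectedComponents.mk (Classical.arbitrary A), hPt _ _⟩⟩
    induction x using Quotient.inductionOn
    induction y using Quotient.inductionOn
    exact Quotient.sound (isPreconnected_zigzag _ _)
  · intro h
    obtain ⟨x, -⟩ := h.2 (CategoryTheory.ConnectedComponents.mk (⟨⟨⟩⟩ : Pt.{u}))
    have : Nonempty A := ⟨x.out⟩
    exact zigzag_isConnected fun a b ↦ Quotient.exact (h.1 (hPt
      ((Functor.star.{u} A).mapConnectedComponents (CategoryTheory.ConnectedComponents.mk a))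
      ((Functor.star.{u} A).mapConnectedComponents (CategoryTheory.ConnectedComponents.mk b))))

lemma isAspherical_wZero_iff (A : Type u) [SmallCategory A] :
    IsAspherical wZero A ↔ IsConnected A :=
  (isConnected_iff_bijective_star A).symm

lemma mapConnectedComponents_comp {A B C : Type u} [SmallCategory A] [SmallCategory B]
    [SmallCategory C] (F : A ⥤ B) (G : B ⥤ C) :
    (F ⋙ G).mapConnectedComponents = G.mapConnectedComponents ∘ F.mapConnectedComponents := by
  ext x
  induction x using Quotient.inductionOn
  rfl

lemma mapConnectedComponents_id (A : Type u) [SmallCategory A] :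
    (𝟭 A).mapConnectedComponents = id := by
  ext x
  induction x using Quotient.inductionOn
  rfl

lemma isConnected_of_bijective {A B : Type u} [SmallCategory A] [SmallCategory B] (F : A ⥤ B)
    (hF : Function.Bijective F.mapConnectedComponents) [IsConnected B] : IsConnected A := by
  rw [isConnected_iff_bijective_star]
  have := ((isConnected_iff_bijective_star B).1 inferInstance).comp hF
  rwa [← mapConnectedComponents_comp] at this

lemma bijective_mapConnectedComponents_of_initial {A B : Type u} [SmallCategory A]
    [SmallCategory B] (F : A ⥤ B) [F.Initial] : Function.Bijective F.mapConnectedComponents := by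
  -- Zigzags lift step by step: each arrow of `B` transports slice objects, and every slice is
  -- connected.
  have hz {b b' : B} (h : Zigzag b b') (z : CostructuredArrow F b)
      (z' : CostructuredArrow F b') : Zigzag z.left z'.left := by
    induction h with
    | refl => exact zigzag_obj_of_zigzag (CostructuredArrow.proj F b) (isPreconnected_zigzag z z')
    | @tail c d _ hcd ih =>
      obtain ⟨w⟩ : Nonempty (CostructuredArrow F c) := inferInstance
      refine (ih w).trans ?_
      rcases hcd with ⟨⟨f⟩⟩ | ⟨⟨f⟩⟩
      · exact zigzag_obj_of_zigzag (CostructuredArrow.proj F d)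
          (isPreconnected_zigzag ((CostructuredArrow.map f).obj w) z')
      · exact zigzag_obj_of_zigzag (CostructuredArrow.proj F c)
          (isPreconnected_zigzag w ((CostructuredArrow.map f).obj z'))
  constructor
  · intro x y hxy
    induction x using Quotient.inductionOn
    induction y using Quotient.inductionOn
    exact Quotient.sound (hz (Quotient.exact hxy) (CostructuredArrow.mk (𝟙 _))
      (CostructuredArrow.mk (𝟙 _)))
  · intro y
    induction y using Quotient.inductionOn with | h b =>
    obtain ⟨z⟩ : Nonempty (CostructuredArrow F b) := inferInstance
    exact ⟨CategoryTheory.ConnectedComponents.mk z.left, Quotient.sound (Zigzag.of_hom z.hom)⟩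

lemma isWeakFundamentalLocalizer_wZero : IsWeakFundamentalLocalizer wZero.{u} where
  containsIdentities := ⟨fun A ↦ by
    change Function.Bijective (𝟭 A).mapConnectedComponents
    rw [mapConnectedComponents_id]
    exact Function.bijective_id⟩
  twoOutOfThree :=
    { comp_mem F G hF hG := by
        change Function.Bijective (F.toFunctor ⋙ G.toFunctor).mapConnectedComponents
        rw [mapConnectedComponents_comp]
        exact Function.Bijective.comp hG hF
      of_postcomp F G hG h := by
        change Function.Bijective (F.toFunctor ⋙ G.toFunctor).mapConnectedComponents at h
        rw [mapConnectedComponents_comp] at h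
        exact (Function.Bijective.of_comp_iff' hG _).1 h
      of_precomp F G hF h := by
        change Function.Bijective (F.toFunctor ⋙ G.toFunctor).mapConnectedComponents at h
        rw [mapConnectedComponents_comp] at h
        exact (Function.Bijective.of_comp_iff _ hF).1 h }
  of_retraction {A₁ A} i r hir h := by
    have h₁ : r.toFunctor.mapConnectedComponents ∘ i.toFunctor.mapConnectedComponents = id := by
      rw [← mapConnectedComponents_comp, ← mapConnectedComponents_id]
      exact congrArg (fun F : A₁ ⟶ A₁ ↦ F.toFunctor.mapConnectedComponents) hir
    change Function.Bijective (r.toFunctor ⋙ i.toFunctor).mapConnectedComponents at h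
    rw [mapConnectedComponents_comp] at h
    exact ⟨h.1.of_comp, (Function.LeftInverse.surjective (congrFun h₁))⟩
  aspherical_of_hasTerminal A _ _ :=
    (isAspherical_wZero_iff A).2 (isConnected_of_hasTerminal A)
  of_over {A B} _ _ F hF := by
    have : F.Initial := ⟨fun b ↦ by
      have : IsConnected (Over b) := isConnected_of_hasTerminal _
      exact isConnected_of_bijective (CostructuredArrow.toOver F b) (hF b)⟩
    exact bijective_mapConnectedComponents_of_initial F

/-! ### Guitart exact squares -/

section

variable {C₁ C₂ C₃ C₄ : Type u} [SmallCategory C₁] [SmallCategory C₂] [SmallCategory C₃]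
  [SmallCategory C₄] {T : C₁ ⥤ C₂} {L : C₁ ⥤ C₃} {R : C₂ ⥤ C₄} {B : C₃ ⥤ C₄}
  (w : TwoSquare T L R B)

open Functor

lemma costructuredArrow_comm {x : C₂} {y : C₃} {p q : CostructuredArrow L y} (f : p ⟶ q)
    (a : x ⟶ T.obj p.left) :
    R.map (a ≫ T.map f.left) ≫ w.app q.left ≫ B.map q.hom =
      R.map a ≫ w.app p.left ≫ B.map p.hom := by
  have := w.naturality_assoc f.left (B.map q.hom)
  dsimp at this
  rw [R.map_comp, Category.assoc, this, ← B.map_comp, CostructuredArrow.w]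

/-- The arrow `R x ⟶ B y` attached to a representative is constant along the colimit relation, so a
chain of relations starting over `g` remains over `g` and becomes a zigzag there. -/
lemma zigzag_rightwards_of_eqvGen {x : C₂} {y : C₃}
    {p q : Σ j, (CostructuredArrow.proj L y ⋙ T ⋙ coyoneda.obj (Opposite.op x)).obj j}
    (h : Relation.EqvGen (Functor.ColimitTypeRel
      (CostructuredArrow.proj L y ⋙ T ⋙ coyoneda.obj (Opposite.op x))) p q)
    (g : R.obj x ⟶ B.obj y) :
    ∃ e : R.map p.2 ≫ w.app p.1.left ≫ B.map p.1.hom = g ↔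
        R.map q.2 ≫ w.app q.1.left ≫ B.map q.1.hom = g, ∀ hp,
      Zigzag (TwoSquare.StructuredArrowRightwards.mk w g p.1.left p.2 p.1.hom hp)
        (TwoSquare.StructuredArrowRightwards.mk w g q.1.left q.2 q.1.hom (e.1 hp)) := by
  induction h with
  | rel p q r =>
    obtain ⟨p, a⟩ := p
    obtain ⟨q, a'⟩ := q
    obtain ⟨f, hf⟩ := r
    dsimp at f hf
    obtain rfl : a' = a ≫ T.map f.left := hf
    have e := costructuredArrow_comm w f a
    refine ⟨⟨e.trans, e.symm.trans⟩, fun hp ↦ Zigzag.of_hom (StructuredArrow.homMk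
      (CostructuredArrow.homMk f.left (CostructuredArrow.w f)) ?_)⟩
    ext
    rfl
  | refl => exact ⟨Iff.rfl, fun _ ↦ Relation.ReflTransGen.refl⟩
  | symm p q _ ih => exact ⟨ih.1.symm, fun hp ↦ (ih.2 (ih.1.2 hp)).symm⟩
  | trans p q r _ _ ih₁ ih₂ =>
    exact ⟨ih₁.1.trans ih₂.1, fun hp ↦ (ih₁.2 hp).trans (ih₂.2 _)⟩

lemma guitartExact_of_isIso_lanBaseChange (h : IsIso (w.lanBaseChange (D := Type u))) :
    w.GuitartExact := by
  rw [TwoSquare.guitartExact_iff_isConnected_rightwards]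
  intro x y g
  -- On this representable, invertible base change makes `E₁` a left Kan extension, so its value at
  -- `y` is a colimit.
  let F := coyoneda.obj (Opposite.op x)
  have hF : IsIso (w.lanBaseChange.app F) := inferInstance
  rw [TwoSquare.isIso_lanBaseChange_app_iff] at hF
  let E₂ : R.LeftExtension F := LeftExtension.mk _ (R.lanUnit.app F)
  let E₁ := E₂.compTwoSquare w
  have h₁ : IsColimit (E₁.coconeAt y) :=
    isPointwiseLeftKanExtensionOfIsLeftKanExtension _ E₁.hom y
  have h₂ : IsColimit (E₂.coconeAt (B.obj y)) :=
    isPointwiseLeftKanExtensionOfIsLeftKanExtension (F := F) _ (R.lanUnit.app F) (B.obj y)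
  have hι (j : CostructuredArrow L y) (a : x ⟶ T.obj j.left) :
      (E₁.coconeAt y).ι.app j a =
        (E₂.coconeAt (B.obj y)).ι.app ((w.costructuredArrowRightwards y).obj j) a := by
    have h₃ : (E₁.coconeAt y).ι.app j =
        (E₂.coconeAt (B.obj y)).ι.app ((w.costructuredArrowRightwards y).obj j) := by
      change (E₂.hom.app (T.obj j.left) ≫ 𝟙 _ ≫ E₂.right.map (w.natTrans.app j.left) ≫ 𝟙 _) ≫
        E₂.right.map (B.map j.hom) =
        E₂.hom.app (T.obj j.left) ≫ E₂.right.map (w.natTrans.app j.left ≫ B.map j.hom)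
      rw [Category.id_comp, Category.comp_id, Category.assoc, E₂.right.map_comp]
    exact ConcreteCategory.congr_hom h₃ a
  -- This cocone recovers an arrow `R x ⟶ B y` from each element of the colimit; it sends `t` below
  -- to `g`.
  let c : Cocone (CostructuredArrow.proj R (B.obj y) ⋙ F) :=
    { pt := R.obj x ⟶ B.obj y
      ι :=
        { app k := ↾fun a ↦ R.map a ≫ k.hom
          naturality k l f := by
            have h₃ (a : x ⟶ k.left) : R.map (a ≫ f.left) ≫ l.hom = R.map a ≫ k.hom := by
              rw [R.map_comp, Category.assoc, CostructuredArrow.w]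
            ext a
            exact h₃ a } }
  have hc (k : CostructuredArrow R (B.obj y)) (a : x ⟶ k.left) :
      h₂.desc c ((E₂.coconeAt (B.obj y)).ι.app k a) = R.map a ≫ k.hom :=
    ConcreteCategory.congr_hom (h₂.fac c k) a
  let t := (E₂.coconeAt (B.obj y)).ι.app (CostructuredArrow.mk g) (𝟙 x)
  have ht (X : C₁) (a : x ⟶ T.obj X) (b : L.obj X ⟶ y)
      (comm : R.map a ≫ w.app X ≫ B.map b = g) :
      (E₁.coconeAt y).ι.app (CostructuredArrow.mk b) a = t := by
    let m : CostructuredArrow.mk g ⟶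
        (w.costructuredArrowRightwards y).obj (CostructuredArrow.mk b) :=
      CostructuredArrow.homMk a comm
    have h₃ : (E₂.coconeAt (B.obj y)).ι.app
        ((w.costructuredArrowRightwards y).obj (CostructuredArrow.mk b))
        (𝟙 x ≫ a : x ⟶ T.obj X) = t :=
      ConcreteCategory.congr_hom ((E₂.coconeAt (B.obj y)).w m) (𝟙 x)
    exact (hι (CostructuredArrow.mk b) a).trans ((congrArg _ (Category.id_comp a).symm).trans h₃)
  have : Nonempty (w.StructuredArrowRightwards g) := by
    obtain ⟨j, a, ha⟩ := Types.jointly_surjective _ h₁ t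
    refine ⟨TwoSquare.StructuredArrowRightwards.mk w g j.left a j.hom ?_⟩
    exact (hc ((w.costructuredArrowRightwards y).obj j) a).symm.trans
      ((congrArg (h₂.desc c) ((hι j a).symm.trans ha)).trans
        ((hc (CostructuredArrow.mk g) (𝟙 x)).trans (by simp)))
  refine zigzag_isConnected fun z z' ↦ ?_
  obtain ⟨X, a, b, comm, rfl⟩ := z.mk_surjective
  obtain ⟨X', a', b', comm', rfl⟩ := z'.mk_surjective
  -- Both objects represent `t`; moving to the chosen colimit turns this equality into a chain of
  -- generating relations.
  have h₃ := congrArg (h₁.desc (colimit.cocone _))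
    ((ht X a b comm).trans (ht X' a' b' comm').symm)
  have h₄ := Types.colimit_eq
    ((ConcreteCategory.congr_hom (h₁.fac (colimit.cocone _) (CostructuredArrow.mk b)) a).symm.trans
      (h₃.trans (ConcreteCategory.congr_hom
        (h₁.fac (colimit.cocone _) (CostructuredArrow.mk b')) a')))
  obtain ⟨e, he⟩ := zigzag_rightwards_of_eqvGen w h₄ g
  exact he comm

end

/-- Presheaves live on opposite categories, so the criterion is applied to the opposite square and
transferred by self-duality. -/
lemma Square.isGuitartExact_iff (D : Square.{u}) : D.IsGuitartExact ↔ D.cell.GuitartExact :=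
  ⟨fun h ↦ TwoSquare.guitartExact_op_iff _ |>.1 (guitartExact_of_isIso_lanBaseChange _ h),
    fun _ ↦ inferInstanceAs (IsIso ((TwoSquare.op D.cell).lanBaseChange (D := Type u)))⟩

lemma Square.isExact_wZero_iff (D : Square.{u}) :
    D.IsExact wZero ↔ D.cell.GuitartExact := by
  rw [isWeakFundamentalLocalizer_wZero.isExact_iff,
    TwoSquare.guitartExact_iff_isConnected_rightwards]
  simp only [isAspherical_wZero_iff]

end ExactSquares

theorem mainTheorem3 :
    (∀ W : MorphismProperty Cat.{u, u}, ExactSquares.IsWeakFundamentalLocalizer W →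
      IsLeast {Q : Set ExactSquares.Square.{u} |
          ExactSquares.IsStableClass (fun A _ => ExactSquares.IsAspherical W A) Q}
        {D : ExactSquares.Square.{u} | D.IsExact W}) ∧
    ExactSquares.IsWeakFundamentalLocalizer ExactSquares.wZero.{u} ∧
    (∀ D : ExactSquares.Square.{u}, D.IsGuitartExact ↔ D.IsExact ExactSquares.wZero) ∧
    IsLeast {Q : Set ExactSquares.Square.{u} |
        ExactSquares.IsStableClass (fun A _ => IsConnected A) Q}
      {D : ExactSquares.Square.{u} | D.IsGuitartExact} := by
  have hG (D : ExactSquares.Square.{u}) : D.IsGuitartExact ↔ D.IsExact ExactSquares.wZero :=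
    D.isGuitartExact_iff.trans D.isExact_wZero_iff.symm
  refine ⟨fun W hW ↦ hW.isLeast_isExact, ExactSquares.isWeakFundamentalLocalizer_wZero, hG, ?_⟩
  have h := ExactSquares.isWeakFundamentalLocalizer_wZero.{u}.isLeast_isExact
  simp only [ExactSquares.isAspherical_wZero_iff] at h
  simpa only [hG] using h
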